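/- For a finite set $\mathcal P$ of points and a finite set $\mathcal H$ of hyperplanes in $\mathbb R^d$, let $I(\mathcal P,\mathcal H)$ be the number of pairs $(p,h)\in\mathcal P\times\mathcal H$ with $p\in h$. The incidence graph of $\mathcal P\times\mathcal H$ is the bipartite graph with sides $\mathcal P$ and $\mathcal H$ whose edges are these pairs; it contains a copy of $K_{s,r}$ if some $s$ distinct points of $\mathcal P$ all lie on each of some $r$ distinct hyperplanes of $\mathcal H$. **Theorem.** For every integer $d\ge 2$ there exists a constant $t$, depending only on $d$, such that the following hold for every $\varepsilon>0$. (a) For every $C$ there is a constant $c>0$, depending only on $d,\varepsilon,C$, such that for all positive integers $m,n$ with $m\le Cn^d$ there exist a set $\mathcal P$ of $m$ points and a set $\mathcal H$ of $n$ hyperplanes, both in $\mathbb R^d$, such that the incidence graph of $\mathcal P\times\mathcal H$ contains no $K_{2,t+1}$ and $$I(\mathcal P,\mathcal H)\ \ge\ c\left(m^{\frac{2d-2}{2d-1}}\,n^{\frac{d}{2d-1}-\varepsilon}+m+n\right).$$ (b) If $d\ge 4$, then for every $C$ there is a constant $c>0$, depending only on $d,\varepsilon,C$, such that for all positive integers $m,n$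 with $m\le Cn^{d-2}$ there exist a set $\mathcal P$ of $m$ points and a set $\mathcal H$ of $n$ hyperplanes, both in $\mathbb R^d$, such that the incidence graph of $\mathcal P\times\mathcal H$ contains no $K_{3,t+1}$ and $$I(\mathcal P,\mathcal H)\ \ge\ c\left(m^{\frac{3d^2-9d+2}{(d-2)(3d-1)}}\,n^{\frac{2d}{3d-1}-\varepsilon}+m+n\right).$$ -/

import Mathlib

/-- A hyperplane of `ℝ^d`: an affine subspace of dimension `d - 1`. -/
def IsHyperplane {d : ℕ} (h : AffineSubspace ℝ (EuclideanSpace ℝ (Fin d))) : Prop :=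
  (h : Set (EuclideanSpace ℝ (Fin d))).Nonempty ∧ Module.finrank ℝ h.direction + 1 = d

/-- The number `I(P, H)` of incidences: pairs `(p, h) ∈ P × H` with `p ∈ h`. -/
noncomputable def incidences {d : ℕ} (P : Finset (EuclideanSpace ℝ (Fin d)))
    (H : Finset (AffineSubspace ℝ (EuclideanSpace ℝ (Fin d)))) : ℕ :=
  Set.ncard {q : EuclideanSpace ℝ (Fin d) × AffineSubspace ℝ (EuclideanSpace ℝ (Fin d)) |
    q.1 ∈ P ∧ q.2 ∈ H ∧ q.1 ∈ q.2}

/-- The incidence graph of `P × H`, a bipartite graph with sides `P` and `H`, contains a copy of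
`K_{s,t}`: there are `s` distinct points of `P` that all lie on each of `t` distinct elements
of `H`. -/
def ContainsK {d : ℕ} (s t : ℕ) (P : Finset (EuclideanSpace ℝ (Fin d)))
    (H : Finset (AffineSubspace ℝ (EuclideanSpace ℝ (Fin d)))) : Prop :=
  ∃ S ⊆ P, ∃ T ⊆ H, S.card = s ∧ T.card = t ∧ ∀ p ∈ S, ∀ h ∈ T, p ∈ h

/-!
Following Dvir and Lovett, consider over `𝔽_p` the variety given by `d - 1 - s` diagonal power sum
equations whose exponents double from one coordinate to the next, together with the normalization
that the last coordinate is `1`. It meets every linear subspace of dimension `d - s` in boundedly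
many points, because on such a subspace every monomial reduces to a bounded box of exponents, and by
pigeonhole some choice of right-hand sides leaves at least `p ^ s` points. Dirichlet's argument
rescales each of them to an integer vector with small entries; a linear dependence among these
integer vectors would persist modulo `p`, so over `ℝ` they are as evasive as the original points.

These vectors are the normals of the hyperplanes `⟪u, y⟫ = r`, where `r` runs over the few integers
that `⟪u, x⟫` can take on lattice points `x` of a small cube. Every such point lies on one
hyperplane for each normal, while `s + 1` affinely independent points confine the normals of the
hyperplanes through them to a subspace of dimension `d - s`, hence to boundedly many. For `K_{2,t}`
all lattice points of a cube are allowed; for `K_{3,t}` the points are taken on one sphere, where no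
three are collinear. When `m` and `n` are so unbalanced that the linear terms dominate, a star
suffices: all points on one hyperplane and all hyperplanes through one point.
-/

section WeightedMonomials

open scoped Matrix

/-- The span of the monomials in the family `x` of weighted degree at most `W`, where `x j` has
weight `w j`. It is a filtration of the algebra generated by `x`. -/
def weightLE (F : Type*) {B ι : Type*} [CommSemiring F] [CommSemiring B] [Algebra F B] [Fintype ι]
    (x : ι → B) (w : ι → ℕ) (W : ℕ) : Submodule F B :=
  Submodule.span F {y | ∃ a : ι → ℕ, a ⬝ᵥ w ≤ W ∧ ∏ j, x j ^ a j = y}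

namespace weightLE

variable {F B ι : Type*} [CommSemiring F] [CommSemiring B] [Algebra F B] [Fintype ι]
  {x : ι → B} {w : ι → ℕ} {U V W : ℕ}

theorem prod_pow_mem {a : ι → ℕ} (ha : a ⬝ᵥ w ≤ W) : ∏ j, x j ^ a j ∈ weightLE F x w W :=
  Submodule.subset_span ⟨a, ha, rfl⟩

theorem mono (h : U ≤ V) : weightLE F x w U ≤ weightLE F x w V :=
  Submodule.span_mono fun _ ⟨a, ha, hy⟩ => ⟨a, ha.trans h, hy⟩

theorem one_mem : (1 : B) ∈ weightLE F x w W := by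
  simpa using prod_pow_mem (F := F) (x := x) (a := 0) (w := w) (W := W) (by simp)

theorem self_mem {i : ι} (hi : w i ≤ W) : x i ∈ weightLE F x w W := by
  classical
  simpa [Pi.single_apply] using prod_pow_mem (F := F) (x := x) (a := Pi.single i 1) (by simpa)

theorem mul_le : weightLE F x w U * weightLE F x w V ≤ weightLE F x w (U + V) := by
  rw [weightLE, weightLE, Submodule.span_mul_span, Submodule.span_le]
  rintro _ ⟨_, ⟨a, ha, rfl⟩, _, ⟨b, hb, rfl⟩, rfl⟩
  simp only [← Finset.prod_mul_distrib, ← pow_add]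
  exact prod_pow_mem (a := a + b) (by rw [add_dotProduct]; exact add_le_add ha hb)

theorem pow_mem {y : B} (hy : y ∈ weightLE F x w W) (n : ℕ) : y ^ n ∈ weightLE F x w (n * W) := by
  induction n with
  | zero => simpa using one_mem
  | succ n ih =>
    rw [pow_succ, add_one_mul]
    exact mul_le (Submodule.mul_mem_mul ih hy)

theorem le_span_prod_pow_lt {e M : ι → ℕ} (hM : ∀ j, M j < e j * w j)
    (hx : ∀ j, x j ^ e j ∈ weightLE F x w (M j)) (W : ℕ) :
    weightLE F x w W ≤
      Submodule.span F (Set.range fun b : ∀ j, Fin (e j) => ∏ j, x j ^ (b j : ℕ)) := by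
  classical
  induction W using Nat.strong_induction_on with
  | _ W ih =>
    refine Submodule.span_le.2 ?_
    rintro _ ⟨a, ha, rfl⟩
    by_cases! hae : ∀ j, a j < e j
    · exact Submodule.subset_span ⟨fun j => ⟨a j, hae j⟩, rfl⟩
    obtain ⟨j, hj⟩ := hae
    obtain ⟨a', rfl⟩ : ∃ a' : ι → ℕ, a = Pi.single j (e j) + a' :=
      exists_add_of_le (update_le_iff.2 ⟨hj, fun _ _ => Nat.zero_le _⟩)
    rw [add_dotProduct, single_dotProduct] at ha
    have hprod : ∏ i, x i ^ (Pi.single j (e j) + a' : ι → ℕ) i = x j ^ e j * ∏ i, x i ^ a' i := by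
      simp only [Pi.add_apply, pow_add, Finset.prod_mul_distrib]
      simp [Pi.single_apply, pow_ite]
    rw [hprod]
    have hlt : M j + a' ⬝ᵥ w < W := by have := hM j; omega
    exact ih _ hlt (mul_le (Submodule.mul_mem_mul (hx j) (prod_pow_mem le_rfl)))

end weightLE

theorem card_le_prod_of_pow_mem_weightLE {F ι X : Type*} [Field F] [Finite F] [Fintype ι]
    [Fintype X] {y : ι → X → F} (hy : Function.Injective fun v j => y j v) {w e M : ι → ℕ}
    (hM : ∀ j, M j < e j * w j) (hpow : ∀ j, y j ^ e j ∈ weightLE F y w (M j)) :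
    Fintype.card X ≤ ∏ j, e j := by
  classical
  have := Fintype.ofFinite F
  have hspan : Submodule.span F (Set.range fun b : ∀ j, Fin (e j) => ∏ j, y j ^ (b j : ℕ)) = ⊤ := by
    refine eq_top_iff.2 fun g _ => ?_
    obtain ⟨P, -, hP⟩ : Function.extend (fun v j => y j v) g 0 ∈
        (MvPolynomial.restrictDegree ι F (Fintype.card F - 1)).map (MvPolynomial.evalₗ F ι) := by
      rw [MvPolynomial.map_restrict_dom_evalₗ]
      trivial
    have hg : g = ∑ a ∈ P.support, P.coeff a • ∏ j, y j ^ a j := by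
      ext v
      rw [← hy.extend_apply g 0 v, ← hP]
      simp [MvPolynomial.evalₗ_apply, MvPolynomial.eval_eq', Finset.sum_apply]
    rw [hg]
    exact Submodule.sum_mem _ fun a _ => Submodule.smul_mem _ _
      (weightLE.le_span_prod_pow_lt hM hpow _ (weightLE.prod_pow_mem le_rfl))
  have hcard := finrank_range_le_card (R := F) fun b : ∀ j, Fin (e j) => ∏ j, y j ^ (b j : ℕ)
  rw [Set.finrank, hspan, finrank_top, Module.finrank_fintype_fun_eq_card] at hcard
  simpa using hcard

end WeightedMonomials

section Pivots

variable (F : Type*) {ι V : Type*} [DivisionRing F] [AddCommGroup V] [Module F V] [Fintype ι]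
  [LinearOrder ι]

open Classical in
/-- The indices `j` at which `y j` is linearly independent of the later terms of the family `y`,
i.e. the pivots of Gaussian elimination performed from the last index down to the first. -/
noncomputable def pivots (y : ι → V) : Finset ι :=
  {j | y j ∉ Submodule.span F (y '' Set.Ioi j)}

variable {F}

theorem mem_pivots {y : ι → V} {j : ι} :
    j ∈ pivots F y ↔ y j ∉ Submodule.span F (y '' Set.Ioi j) := by
  simp [pivots]

theorem linearIndepOn_pivots (y : ι → V) : LinearIndepOn F y (pivots F y) := by
  suffices ∀ J ⊆ pivots F y, LinearIndepOn F y J from this _ subset_rfl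
  intro J
  induction J using Finset.induction_on_min with
  | empty => simp
  | insert j J hj ih =>
    intro hJ
    rw [Finset.insert_subset_iff] at hJ
    rw [Finset.coe_insert]
    exact (ih hJ.2).insert fun hmem =>
      mem_pivots.1 hJ.1 (Submodule.span_mono (Set.image_mono hj) hmem)

theorem card_pivots_le_finrank_range (y : ι → V) :
    (pivots F y).card ≤ Set.finrank F (Set.range y) := by
  have hcard := finrank_span_eq_card (linearIndepOn_pivots (F := F) y)
  simp only [Finset.coe_sort_coe, Fintype.card_coe] at hcard
  have : FiniteDimensional F (Submodule.span F (Set.range y)) :=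
    FiniteDimensional.span_of_finite F (Set.finite_range y)
  rw [← hcard]
  exact Submodule.finrank_mono (Submodule.span_mono (Set.range_comp_subset_range _ y))

end Pivots

section SubspaceEvasive

theorem finrank_range_coordinates {F ι : Type*} [Field F] [Finite ι] (T : Finset (ι → F)) :
    Set.finrank F (Set.range fun (j : ι) (v : T) => v.1 j) = Set.finrank F (T : Set (ι → F)) := by
  have := Fintype.ofFinite ι
  let A : Matrix T ι F := fun v => v
  have hcol := A.rank_eq_finrank_span_cols
  have hrow := A.rank_eq_finrank_span_row
  have hrange : Set.range A.row = (T : Set (ι → F)) := Subtype.range_coe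
  rw [hrange] at hrow
  exact hcol.symm.trans hrow

/-- At most `t` points of `N` lie in any common linear subspace of dimension at most `r`. -/
def IsSubspaceEvasive (K : Type*) {V : Type*} [Ring K] [AddCommGroup V] [Module K V] (r t : ℕ)
    (N : Set V) : Prop :=
  ∀ T : Finset V, (T : Set V) ⊆ N → Set.finrank K (T : Set V) ≤ r → T.card ≤ t

theorem IsSubspaceEvasive.mono {K V : Type*} [Ring K] [AddCommGroup V] [Module K V] {r t : ℕ}
    {M N : Set V} (hN : IsSubspaceEvasive K r t N) (hMN : M ⊆ N) : IsSubspaceEvasive K r t M :=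
  fun T hT => hN T (hT.trans hMN)

theorem mem_of_sum_pow_smul_mem {F ι M : Type*} [Field F] [AddCommGroup M] [Module F M] [Fintype ι]
    {G : Submodule F M} {α : ι → F} (hα : Function.Injective α) {z : ι → M} {J : Finset ι} {k : ℕ}
    (hJ : J.card ≤ k) (hsum : ∀ l < k, ∑ i, α i ^ l • z i ∈ G) (hz : ∀ i ∉ J, z i ∈ G) (j : ι) :
    z j ∈ G := by
  classical
  by_cases hj : j ∉ J
  · exact hz j hj
  rw [not_not] at hj
  -- This polynomial vanishes at the nodes of `J` other than `j`, so it isolates the term `z j`.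
  set q := Lagrange.nodal (J.erase j) α
  have hdeg : q.natDegree < k := by
    rw [Lagrange.natDegree_nodal]
    exact (Finset.card_erase_lt_of_mem hj).trans_le hJ
  have hqsum : ∑ i, q.eval (α i) • z i ∈ G := by
    simp only [Polynomial.eval_eq_sum_range' hdeg, Finset.sum_smul, mul_smul]
    rw [Finset.sum_comm]
    refine Submodule.sum_mem _ fun l hl => ?_
    rw [← Finset.smul_sum]
    exact G.smul_mem _ (hsum l (Finset.mem_range.1 hl))
  have hrest : ∀ i ∈ Finset.univ.erase j, q.eval (α i) • z i ∈ G := by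
    intro i hi
    by_cases hiJ : i ∈ J
    · rw [Lagrange.eval_nodal_at_node (Finset.mem_erase.2 ⟨Finset.ne_of_mem_erase hi, hiJ⟩),
        zero_smul]
      exact G.zero_mem
    · exact G.smul_mem _ (hz i hiJ)
  have hqj : q.eval (α j) ≠ 0 :=
    Lagrange.eval_nodal_not_at_node fun i hi => hα.ne (Finset.ne_of_mem_erase hi).symm
  rw [← Finset.add_sum_erase _ _ (Finset.mem_univ j),
    Submodule.add_mem_iff_left _ (Submodule.sum_mem _ hrest)] at hqsum
  exact (G.smul_mem_iff hqj).1 hqsum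

theorem pow_two_pow_mem_weightLE {F B : Type*} [CommSemiring F] [CommSemiring B] [Algebra F B]
    {D : ℕ} {y : Fin (D + 1) → B} {j : Fin (D + 1)} (hj : j ≠ Fin.last D)
    (hy : y j ∈ Submodule.span F (y '' Set.Ioi j)) :
    y j ^ 2 ^ (j : ℕ) ∈ weightLE F y (fun i => 2 ^ (D - i : ℕ)) (2 ^ D - 1) := by
  have hjD : (j : ℕ) < D := Fin.lt_last_iff_ne_last.2 hj
  have hspan : Submodule.span F (y '' Set.Ioi j) ≤
      weightLE F y (fun i => 2 ^ (D - i : ℕ)) (2 ^ (D - j - 1 : ℕ)) := by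
    rw [Submodule.span_le]
    rintro _ ⟨i, hi, rfl⟩
    have hji : (j : ℕ) < i := hi
    exact weightLE.self_mem (Nat.pow_le_pow_right two_pos (by omega))
  refine weightLE.mono ?_ (weightLE.pow_mem (hspan hy) _)
  rw [← pow_add]
  exact Nat.le_sub_one_of_lt (Nat.pow_lt_pow_right one_lt_two (by omega))

/-- The affine variety of those `v` with last coordinate `1` whose first `k` twisted power sums
`∑ j, α j ^ i * v j ^ 2 ^ j` take the prescribed values `b i`. -/
def powerSumVariety {F : Type*} [Semiring F] {D k : ℕ} (α : Fin (D + 1) → F) (b : Fin k → F) :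
    Set (Fin (D + 1) → F) :=
  {v | v (Fin.last D) = 1 ∧ ∀ i : Fin k, ∑ j, α j ^ (i : ℕ) * v j ^ 2 ^ (j : ℕ) = b i}

theorem isSubspaceEvasive_powerSumVariety {F : Type*} [Field F] [Finite F] {D k : ℕ}
    {α : Fin (D + 1) → F} (hα : Function.Injective α) (b : Fin k → F) :
    IsSubspaceEvasive F (k + 1) (2 ^ (D + 1).choose 2) (powerSumVariety α b) := by
  intro T hT hdim
  rcases T.eq_empty_or_nonempty with rfl | hne
  · simp
  have : Nonempty T := hne.to_subtype
  set y : Fin (D + 1) → T → F := fun j v => v.1 j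
  set G := weightLE F y (fun i => 2 ^ (D - i : ℕ)) (2 ^ D - 1)
  have hlast : y (Fin.last D) = 1 := funext fun v => (hT v.2).1
  have hlast_mem : Fin.last D ∈ pivots F y := by
    rw [mem_pivots, hlast, ← Fin.top_eq_last, Set.Ioi_top]
    simp
  have hcard : ((pivots F y).erase (Fin.last D)).card ≤ k := by
    rw [Finset.card_erase_of_mem hlast_mem, Nat.sub_le_iff_le_add]
    exact (card_pivots_le_finrank_range y).trans ((finrank_range_coordinates T).trans_le hdim)
  have hsum : ∀ l < k, ∑ i, α i ^ l • y i ^ 2 ^ (i : ℕ) ∈ G := by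
    intro l hl
    have hconst : ∑ i, α i ^ l • y i ^ 2 ^ (i : ℕ) = b ⟨l, hl⟩ • (1 : T → F) := by
      ext v
      simpa [y] using (hT v.2).2 ⟨l, hl⟩
    rw [hconst]
    exact G.smul_mem _ weightLE.one_mem
  have hnonpivot : ∀ i ∉ (pivots F y).erase (Fin.last D), y i ^ 2 ^ (i : ℕ) ∈ G := by
    intro i hi
    by_cases hil : i = Fin.last D
    · rw [hil, hlast, one_pow]
      exact weightLE.one_mem
    · simp only [Finset.mem_erase, ne_eq, hil, not_false_eq_true, true_and, mem_pivots,
        not_not] at hi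
      exact pow_two_pow_mem_weightLE hil hi
  have hpow := mem_of_sum_pow_smul_mem hα hcard hsum hnonpivot
  have hweight : ∀ j : Fin (D + 1), 2 ^ D - 1 < 2 ^ (j : ℕ) * 2 ^ (D - j : ℕ) := by
    intro j
    rw [← pow_add, Nat.add_sub_cancel' j.is_le]
    exact Nat.sub_lt (by positivity) one_pos
  have hbound := card_le_prod_of_pow_mem_weightLE (fun _ _ h => Subtype.ext h) hweight hpow
  rwa [Fintype.card_coe, Finset.prod_pow_eq_pow_sum, Fin.sum_univ_eq_sum_range (fun j => j),
    Finset.sum_range_id, ← Nat.choose_two_right] at hbound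

theorem exists_subset_powerSumVariety {F : Type*} [Field F] [Fintype F] {D k s : ℕ}
    (hks : k + s = D) (α : Fin (D + 1) → F) :
    ∃ (b : Fin k → F) (X : Finset (Fin (D + 1) → F)),
      (X : Set (Fin (D + 1) → F)) ⊆ powerSumVariety α b ∧ Fintype.card F ^ s ≤ X.card := by
  classical
  let E : (Fin D → F) → Fin (D + 1) → F := fun v => Fin.snoc (α := fun _ => F) v 1
  have hE : Function.Injective E := fun v v' h => by
    simpa [E, Fin.init_snoc] using congrArg (Fin.init (α := fun _ => F)) h
  obtain ⟨b, -, hb⟩ := Finset.exists_le_card_fiber_of_mul_le_card_of_maps_to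
    (s := Finset.univ.image E) (t := Finset.univ) (n := Fintype.card F ^ s)
    (f := fun v (i : Fin k) => ∑ j, α j ^ (i : ℕ) * v j ^ 2 ^ (j : ℕ))
    (fun _ _ => Finset.mem_univ _) Finset.univ_nonempty (by
      rw [Finset.card_image_of_injective _ hE]
      simp [← pow_add, hks])
  refine ⟨b, _, fun v hv => ?_, hb⟩
  obtain ⟨hvE, hvb⟩ := Finset.mem_filter.1 hv
  obtain ⟨v, -, rfl⟩ := Finset.mem_image.1 hvE
  exact ⟨Fin.snoc_last _ _, fun i => congrFun hvb i⟩

end SubspaceEvasive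

section IntegerLift

theorem linearIndependent_int_of_zmod {p : ℕ} [Fact p.Prime] {ι κ : Type*} {u : ι → κ → ℤ}
    (hu : LinearIndependent (ZMod p) fun i j => (u i j : ZMod p)) : LinearIndependent ℤ u := by
  rw [linearIndependent_iff'] at hu ⊢
  intro s g hg i hi
  obtain ⟨g', hg', hgcd⟩ := Finset.extract_gcd g ⟨i, hi⟩
  rcases eq_or_ne (s.gcd g) 0 with h0 | h0
  · rw [hg' i hi, h0, zero_mul]
  have hsum : ∑ i ∈ s, g' i • u i = 0 := by
    refine (smul_eq_zero_iff_right h0).1 ?_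
    rw [Finset.smul_sum, ← hg]
    exact Finset.sum_congr rfl fun i hi => by rw [hg' i hi, mul_smul]
  have hmod : ∑ i ∈ s, (g' i : ZMod p) • (fun j => (u i j : ZMod p)) = 0 := by
    ext j
    simpa using congrArg (Int.cast : ℤ → ZMod p) (congrFun hsum j)
  have hp : (p : ℤ) ∣ s.gcd g' :=
    Finset.dvd_gcd fun i hi => (ZMod.intCast_zmod_eq_zero_iff_dvd _ _).1 (hu s _ hmod i hi)
  rw [hgcd] at hp
  exact absurd (Int.natCast_dvd_natCast.1 (by simpa using hp)) (Fact.out : p.Prime).not_dvd_one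

theorem exists_small_multiple {p q K : ℕ} [NeZero p] {ι : Type*} [Fintype ι]
    (hq : q ^ Fintype.card ι < p) (hK : p ≤ q * K) (v : ι → ZMod p) :
    ∃ c : ZMod p, c ≠ 0 ∧ ∃ u : ι → ℤ, (∀ i, (u i : ZMod p) = c * v i) ∧ ∀ i, |u i| ≤ K := by
  classical
  have hK0 : 0 < K := Nat.pos_of_ne_zero fun h => NeZero.ne p (by simpa [h] using hK)
  have hlt (c : ZMod p) (i : ι) : (c * v i).val / K < q :=
    (Nat.div_lt_iff_lt_mul hK0).2 ((ZMod.val_lt _).trans_le hK)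
  obtain ⟨c, c', hne, hcc'⟩ := Fintype.exists_ne_map_eq_of_card_lt
    (fun c i => (⟨(c * v i).val / K, hlt c i⟩ : Fin q)) (by simpa [ZMod.card] using hq)
  refine ⟨c - c', sub_ne_zero.2 hne, fun i => (c * v i).val - (c' * v i).val, fun i => ?_,
    fun i => ?_⟩
  · push_cast
    rw [ZMod.natCast_zmod_val, ZMod.natCast_zmod_val, sub_mul]
  · have hdiv : (c * v i).val / K = (c' * v i).val / K := congrArg Fin.val (congrFun hcc' i)
    have hc := Nat.div_add_mod (c * v i).val K
    have hc' := Nat.div_add_mod (c' * v i).val K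
    have hmod := Nat.mod_lt (c * v i).val hK0
    have hmod' := Nat.mod_lt (c' * v i).val hK0
    rw [hdiv] at hc
    dsimp only
    rw [abs_le]
    constructor <;> omega

/-- The vector of `ℝ^d` with the given integer coordinates. -/
noncomputable def latticeVec {d : ℕ} (u : Fin d → ℤ) : EuclideanSpace ℝ (Fin d) :=
  WithLp.toLp 2 fun i => (u i : ℝ)

theorem latticeVec_injective {d : ℕ} : Function.Injective (latticeVec (d := d)) := by
  intro u v h
  ext i
  simpa [latticeVec] using congrArg (fun x : EuclideanSpace ℝ (Fin d) => x i) h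

theorem inner_latticeVec {d : ℕ} (u v : Fin d → ℤ) :
    inner ℝ (latticeVec u) (latticeVec v) = ((∑ i, u i * v i : ℤ) : ℝ) := by
  simp [latticeVec, PiLp.inner_apply, mul_comm]

/-- The integer points of the cube `[-a, a]^d`. -/
noncomputable def latticeCube (d a : ℕ) : Finset (EuclideanSpace ℝ (Fin d)) :=
  (Fintype.piFinset fun _ => Finset.Icc (-a : ℤ) a).map ⟨latticeVec, latticeVec_injective⟩

theorem mem_latticeCube {d a : ℕ} {x : EuclideanSpace ℝ (Fin d)} :
    x ∈ latticeCube d a ↔ ∃ u : Fin d → ℤ, (∀ i, |u i| ≤ a) ∧ latticeVec u = x := by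
  simp [latticeCube, abs_le]

theorem card_latticeCube (d a : ℕ) : (latticeCube d a).card = (2 * a + 1) ^ d := by
  simp only [latticeCube, Finset.card_map, Fintype.card_piFinset_const, Int.card_Icc]
  congr
  omega

theorem exists_inner_eq_of_mem_latticeCube {d a b : ℕ} {x y : EuclideanSpace ℝ (Fin d)}
    (hx : x ∈ latticeCube d a) (hy : y ∈ latticeCube d b) :
    ∃ z : ℤ, |z| ≤ d * (a * b) ∧ inner ℝ x y = z := by
  obtain ⟨u, hu, rfl⟩ := mem_latticeCube.1 hx
  obtain ⟨v, hv, rfl⟩ := mem_latticeCube.1 hy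
  refine ⟨_, ?_, inner_latticeVec u v⟩
  calc |∑ i, u i * v i| ≤ ∑ i : Fin d, |u i * v i| := Finset.abs_sum_le_sum_abs _ _
    _ ≤ ∑ _i : Fin d, (a * b : ℤ) := Finset.sum_le_sum fun i _ => by
        rw [abs_mul]
        exact mul_le_mul (hu i) (hv i) (abs_nonneg _) (by positivity)
    _ = d * (a * b) := by simp

theorem linearIndependent_latticeVec_of_zmod {p d : ℕ} [Fact p.Prime] {ι : Type*}
    {v : ι → Fin d → ZMod p} (hv : LinearIndependent (ZMod p) v) {c : ι → ZMod p}
    (hc : ∀ i, c i ≠ 0) {u : ι → Fin d → ℤ} (hu : ∀ i j, (u i j : ZMod p) = c i * v i j) :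
    LinearIndependent ℝ fun i => latticeVec (u i) := by
  have hmod : LinearIndependent (ZMod p) fun i j => (u i j : ZMod p) := by
    convert hv.units_smul fun i => Units.mk0 (c i) (hc i) using 1
    ext i j
    simp [hu, Units.smul_def]
  have hreal : LinearIndependent ℝ fun i j => (u i j : ℝ) :=
    (linearIndependent_algebraMap_comp_iff (S := ℝ) (v := u)).2 (linearIndependent_int_of_zmod hmod)
  exact hreal.map' (WithLp.linearEquiv 2 ℝ (Fin d → ℝ)).symm.toLinearMap (LinearEquiv.ker _)

theorem finrank_le_finrank_image_latticeVec {p d : ℕ} [Fact p.Prime]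
    {c : (Fin d → ZMod p) → ZMod p} (hc : ∀ v, c v ≠ 0) {u : (Fin d → ZMod p) → Fin d → ℤ}
    (hu : ∀ v j, (u v j : ZMod p) = c v * v j) (Y : Set (Fin d → ZMod p)) :
    Set.finrank (ZMod p) Y ≤ Set.finrank ℝ ((fun v => latticeVec (u v)) '' Y) := by
  classical
  obtain ⟨b, hbY, hspan, hb⟩ := exists_linearIndependent (ZMod p) Y
  have := Fintype.ofFinite b
  have hlift := linearIndependent_latticeVec_of_zmod hb (fun i => hc i) (fun i => hu i)
  rw [Set.finrank, ← hspan, finrank_span_set_eq_card hb, Set.toFinset_card,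
    ← finrank_span_eq_card hlift]
  refine Submodule.finrank_mono (Submodule.span_mono ?_)
  rintro _ ⟨i, rfl⟩
  exact ⟨i, hbY i.2, rfl⟩

theorem IsSubspaceEvasive.image_latticeVec {p d r t : ℕ} [Fact p.Prime] {X : Set (Fin d → ZMod p)}
    (hX : IsSubspaceEvasive (ZMod p) r t X) {c : (Fin d → ZMod p) → ZMod p} (hc : ∀ v, c v ≠ 0)
    {u : (Fin d → ZMod p) → Fin d → ℤ} (hu : ∀ v j, (u v j : ZMod p) = c v * v j) :
    IsSubspaceEvasive ℝ r t ((fun v => latticeVec (u v)) '' X) := by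
  classical
  intro T hT hdim
  obtain ⟨Y, hYX, rfl⟩ := Finset.subset_set_image_iff.1 hT
  rw [Finset.coe_image] at hdim
  exact Finset.card_image_le.trans
    (hX Y hYX ((finrank_le_finrank_image_latticeVec hc hu Y).trans hdim))

theorem span_singleton_latticeVec_injOn {p D : ℕ} [Fact p.Prime]
    {c : (Fin (D + 1) → ZMod p) → ZMod p} (hc : ∀ v, c v ≠ 0)
    {u : (Fin (D + 1) → ZMod p) → Fin (D + 1) → ℤ} (hu : ∀ v j, (u v j : ZMod p) = c v * v j) :
    Set.InjOn (fun v => Submodule.span ℝ {latticeVec (u v)}) {v | v (Fin.last D) = 1} := by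
  intro v (hv : _ = _) v' (hv' : _ = _) (hspan : Submodule.span ℝ _ = Submodule.span ℝ _)
  by_contra hne
  have hv0 : v ≠ 0 := fun h => by simp [h] at hv
  have hpair : LinearIndependent (ZMod p) ![v, v'] := by
    refine (LinearIndependent.pair_iff' hv0).2 fun a ha => hne ?_
    have ha1 := congrFun ha (Fin.last D)
    simp only [Pi.smul_apply, smul_eq_mul, hv, hv', mul_one] at ha1
    rw [← ha, ha1, one_smul]
  have hlift := linearIndependent_latticeVec_of_zmod hpair (fun i => hc _) (fun i => hu _)
  have hnot := hlift.notMem_span_image (s := {0}) (x := 1) (by simp)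
  rw [Set.image_singleton] at hnot
  exact hnot (hspan.symm ▸ Submodule.mem_span_singleton_self (latticeVec (u v')))

theorem exists_evasive_normals {d s q : ℕ} (hsd : s + 1 ≤ d) (hq : 1 < q) :
    ∃ N ⊆ latticeCube d (2 * q ^ (d - 1)), N.card = q ^ (d * s) ∧ 0 ∉ N ∧
      Set.InjOn (fun u => Submodule.span ℝ {u}) (N : Set (EuclideanSpace ℝ (Fin d))) ∧
      IsSubspaceEvasive ℝ (d - s) (2 ^ d.choose 2) (N : Set (EuclideanSpace ℝ (Fin d))) := by
  classical
  obtain ⟨D, rfl⟩ : ∃ D, d = D + 1 := ⟨d - 1, by omega⟩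
  obtain ⟨p, hp, hqp, hpq⟩ := Nat.exists_prime_lt_and_le_two_mul (q ^ (D + 1)) (by positivity)
  have : Fact p.Prime := ⟨hp⟩
  let α : Fin (D + 1) → ZMod p := fun j => (j : ℕ)
  have hα : Function.Injective α := by
    have hDp : D + 1 < p := (Nat.lt_pow_self hq).trans hqp
    intro i j hij
    exact Fin.ext (CharP.natCast_injOn_Iio (ZMod p) p (Set.mem_Iio.2 (i.2.trans hDp))
      (Set.mem_Iio.2 (j.2.trans hDp)) hij)
  obtain ⟨b, X, hXb, hX⟩ := exists_subset_powerSumVariety (k := D - s) (s := s) (by omega) α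
  have hK : p ≤ q * (2 * q ^ D) := hpq.trans_eq (by ring)
  choose c hc u hu hsmall using
    exists_small_multiple (ι := Fin (D + 1)) (by simpa using hqp) hK
  have hinj := (span_singleton_latticeVec_injOn hc hu).mono fun v hv => (hXb hv).1
  have hcard : q ^ ((D + 1) * s) ≤ (X.image fun v => latticeVec (u v)).card := by
    have hvec : Set.InjOn (fun v => latticeVec (u v)) X := fun v hv v' hv' h =>
      hinj hv hv' (congrArg (fun x => Submodule.span ℝ {x}) h)
    rw [Finset.card_image_of_injOn hvec, pow_mul]
    exact (Nat.pow_le_pow_left hqp.le s).trans (by simpa [ZMod.card] using hX)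
  obtain ⟨N, hN, hNcard⟩ := Finset.exists_subset_card_eq hcard
  have hNX : (N : Set (EuclideanSpace ℝ (Fin (D + 1)))) ⊆ (fun v => latticeVec (u v)) '' X := by
    exact_mod_cast hN
  refine ⟨N, fun x hx => ?_, hNcard, fun h0 => ?_, ?_, ?_⟩
  · obtain ⟨v, -, rfl⟩ := hNX hx
    exact mem_latticeCube.2 ⟨u v, fun i => by simpa using hsmall v i, rfl⟩
  · obtain ⟨v, hv, hv0⟩ := hNX h0
    have hu0 : u v = 0 := latticeVec_injective (hv0.trans (by ext; simp [latticeVec]))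
    refine hc v ?_
    simpa [hu0, (hXb hv).1] using (hu v (Fin.last D)).symm
  · intro x hx y hy hxy
    obtain ⟨v, hv, rfl⟩ := hNX hx
    obtain ⟨v', hv', rfl⟩ := hNX hy
    rw [hinj hv hv' hxy]
  · have hev := ((isSubspaceEvasive_powerSumVariety hα b).mono hXb).image_latticeVec hc hu
    rw [show D + 1 - s = D - s + 1 by omega]
    exact hev.mono hNX

end IntegerLift

section Hyperplanes

variable {E : Type*} [NormedAddCommGroup E] [InnerProductSpace ℝ E]

/-- The hyperplane `⟪c, y⟫ = r` with normal vector `c`. -/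
def normalHyperplane (c : E) (r : ℝ) : AffineSubspace ℝ E where
  carrier := {y | inner ℝ c y = r}
  smul_vsub_vadd_mem' a x y z hx hy hz := by
    simp only [Set.mem_ofPred_eq] at hx hy hz ⊢
    simp [inner_add_right, inner_smul_right, inner_sub_right, hx, hy, hz]

theorem mem_normalHyperplane {c y : E} {r : ℝ} : y ∈ normalHyperplane c r ↔ inner ℝ c y = r :=
  Iff.rfl

theorem normalHyperplane_nonempty {c : E} (hc : c ≠ 0) (r : ℝ) :
    (normalHyperplane c r : Set E).Nonempty :=
  ⟨(r / inner ℝ c c) • c, by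
    simp [mem_normalHyperplane, inner_smul_right, hc]⟩

theorem direction_normalHyperplane {c : E} (hc : c ≠ 0) (r : ℝ) :
    (normalHyperplane c r).direction = (Submodule.span ℝ {c})ᗮ := by
  obtain ⟨x, hx⟩ := normalHyperplane_nonempty hc r
  have hmk : normalHyperplane c r = AffineSubspace.mk' x (Submodule.span ℝ {c})ᗮ := by
    ext y
    rw [AffineSubspace.mem_mk', Submodule.mem_orthogonal_singleton_iff_inner_right, vsub_eq_sub,
      inner_sub_right, sub_eq_zero, mem_normalHyperplane, mem_normalHyperplane.1 hx]
  rw [hmk, AffineSubspace.direction_mk']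

theorem mem_vectorSpan_orthogonal_of_subset_normalHyperplane {c : E} {r : ℝ} {S : Set E}
    (hS : S ⊆ normalHyperplane c r) : c ∈ (vectorSpan ℝ S)ᗮ := by
  have hortho : vectorSpan ℝ S ⟂ Submodule.span ℝ {c} := by
    refine Submodule.span_le.2 ?_
    rintro _ ⟨x, hx, y, hy, rfl⟩
    rw [SetLike.mem_coe, Submodule.mem_orthogonal_singleton_iff_inner_right]
    simp only [vsub_eq_sub, inner_sub_right, mem_normalHyperplane.1 (hS hx),
      mem_normalHyperplane.1 (hS hy), sub_self]
  exact hortho.symm (Submodule.mem_span_singleton_self c)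

theorem span_eq_span_of_normalHyperplane_eq {c c' : E} (hc : c ≠ 0) (hc' : c' ≠ 0) {r r' : ℝ}
    (h : normalHyperplane c r = normalHyperplane c' r') :
    Submodule.span ℝ {c} = Submodule.span ℝ {c'} := by
  have hdir := congrArg AffineSubspace.direction h
  rw [direction_normalHyperplane hc, direction_normalHyperplane hc'] at hdir
  rw [← Submodule.orthogonal_orthogonal (Submodule.span ℝ {c}), hdir,
    Submodule.orthogonal_orthogonal]

theorem isHyperplane_normalHyperplane {d : ℕ} {c : EuclideanSpace ℝ (Fin d)} (hc : c ≠ 0) (r : ℝ) :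
    IsHyperplane (normalHyperplane c r) := by
  refine ⟨normalHyperplane_nonempty hc r, ?_⟩
  rw [direction_normalHyperplane hc, add_comm, ← finrank_span_singleton (K := ℝ) hc,
    Submodule.finrank_add_finrank_orthogonal, finrank_euclideanSpace_fin]

end Hyperplanes

section Configurations

variable {d s t m n : ℕ} {P : Finset (EuclideanSpace ℝ (Fin d))}
  {H : Finset (AffineSubspace ℝ (EuclideanSpace ℝ (Fin d)))}

theorem card_le_incidences
    {I : Finset (EuclideanSpace ℝ (Fin d) × AffineSubspace ℝ (EuclideanSpace ℝ (Fin d)))}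
    (hI : I ⊆ P ×ˢ H) (hmem : ∀ q ∈ I, q.1 ∈ q.2) : I.card ≤ incidences P H := by
  rw [← Set.ncard_coe_finset]
  refine Set.ncard_le_ncard (fun q hq => ?_)
    ((P ×ˢ H).finite_toSet.subset fun q hq => Finset.mem_product.2 ⟨hq.1, hq.2.1⟩)
  obtain ⟨hP, hH⟩ := Finset.mem_product.1 (hI hq)
  exact ⟨hP, hH, hmem q hq⟩

theorem incidences_mono_right {H' : Finset (AffineSubspace ℝ (EuclideanSpace ℝ (Fin d)))}
    (h : H ⊆ H') : incidences P H ≤ incidences P H' :=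
  Set.ncard_le_ncard (fun _ hq => ⟨hq.1, h hq.2.1, hq.2.2⟩)
    ((P ×ˢ H').finite_toSet.subset fun _ hq => Finset.mem_product.2 ⟨hq.1, hq.2.1⟩)

theorem ContainsK.mono {s' t' : ℕ} (h : ContainsK s t P H) (hs : s' ≤ s) (ht : t' ≤ t) :
    ContainsK s' t' P H := by
  obtain ⟨S, hS, T, hT, rfl, rfl, hST⟩ := h
  obtain ⟨S', hS', hs'⟩ := Finset.exists_subset_card_eq hs
  obtain ⟨T', hT', ht'⟩ := Finset.exists_subset_card_eq ht
  exact ⟨S', hS'.trans hS, T', hT'.trans hT, hs', ht', fun p hp h hh => hST p (hS' hp) h (hT' hh)⟩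

/-- There are `m` points and `n` hyperplanes in `ℝ^d` that span at least `x` incidences, but whose
incidence graph contains no `K_{s,t}`. -/
def HasConfiguration (d s t m n : ℕ) (x : ℝ) : Prop :=
  ∃ (P : Finset (EuclideanSpace ℝ (Fin d)))
    (H : Finset (AffineSubspace ℝ (EuclideanSpace ℝ (Fin d)))),
    P.card = m ∧ H.card = n ∧ (∀ h ∈ H, IsHyperplane h) ∧ ¬ ContainsK s t P H ∧
      x ≤ incidences P H

theorem HasConfiguration.mono {s' t' : ℕ} {x x' : ℝ} (h : HasConfiguration d s t m n x)
    (hs : s ≤ s') (ht : t ≤ t') (hx : x' ≤ x) : HasConfiguration d s' t' m n x' := by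
  obtain ⟨P, H, hP, hH, hyp, hK, hI⟩ := h
  exact ⟨P, H, hP, hH, hyp, fun hK' => hK (hK'.mono hs ht), hx.trans hI⟩

theorem infinite_setOf_isHyperplane_avoiding [NeZero d] (P : Finset (EuclideanSpace ℝ (Fin d))) :
    {h : AffineSubspace ℝ (EuclideanSpace ℝ (Fin d)) |
      IsHyperplane h ∧ ∀ p ∈ P, p ∉ h}.Infinite := by
  classical
  obtain ⟨c, hc⟩ := exists_ne (0 : EuclideanSpace ℝ (Fin d))
  have hinj : Function.Injective (normalHyperplane c) := by
    intro r r' h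
    obtain ⟨x, hx⟩ := normalHyperplane_nonempty hc r
    exact (mem_normalHyperplane.1 hx).symm.trans (mem_normalHyperplane.1 (h ▸ hx))
  have hlevels : ((P.image (inner ℝ c) : Finset ℝ) : Set ℝ)ᶜ.Infinite :=
    (Finset.finite_toSet _).infinite_compl
  refine (hlevels.image hinj.injOn).mono ?_
  rintro _ ⟨r, hr, rfl⟩
  refine ⟨isHyperplane_normalHyperplane hc r, fun p hp hpr => hr ?_⟩
  rw [← mem_normalHyperplane.1 hpr]
  exact Finset.mem_image_of_mem _ hp

theorem hasConfiguration_of_card_le [NeZero d] (hs : s ≠ 0) (hn : H.card ≤ n)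
    (hyp : ∀ h ∈ H, IsHyperplane h) (hK : ¬ ContainsK s t P H) :
    HasConfiguration d s t P.card n (incidences P H) := by
  classical
  obtain ⟨A, hA, hAcard⟩ := ((infinite_setOf_isHyperplane_avoiding P).sdiff
    H.finite_toSet).exists_subset_card_eq (n - H.card)
  have hdisj : Disjoint H A := Finset.disjoint_right.2 fun h hhA => (hA hhA).2
  refine ⟨P, H ∪ A, rfl, ?_, fun h hh => ?_, ?_, ?_⟩
  · rw [Finset.card_union_of_disjoint hdisj, hAcard]
    omega
  · exact (Finset.mem_union.1 hh).elim (hyp h) fun hhA => (hA hhA).1.1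
  · rintro ⟨S, hS, T, hT, rfl, hTcard, hST⟩
    obtain ⟨p, hp⟩ := Finset.card_ne_zero.1 hs
    refine hK ⟨S, hS, T, fun h hh => ?_, rfl, hTcard, hST⟩
    exact (Finset.mem_union.1 (hT hh)).resolve_right fun hhA =>
      (hA hhA).1.2 p (hS hp) (hST p hp h hh)
  · exact_mod_cast incidences_mono_right Finset.subset_union_left

theorem not_containsK_two_two_of_star {p₀ : EuclideanSpace ℝ (Fin d)}
    {h₀ : AffineSubspace ℝ (EuclideanSpace ℝ (Fin d))}
    (hstar : ∀ p ∈ P, ∀ h ∈ H, p ∈ h → p = p₀ ∨ h = h₀) : ¬ ContainsK 2 2 P H := by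
  rintro ⟨S, hS, T, hT, hS2, hT2, hST⟩
  obtain ⟨p, hp, hp₀⟩ := Finset.exists_mem_ne (by omega : 1 < S.card) p₀
  obtain ⟨h, hh, hh₀⟩ := Finset.exists_mem_ne (by omega : 1 < T.card) h₀
  exact (hstar p (hS hp) h (hT hh) (hST p hp h hh)).elim hp₀ hh₀

theorem max_card_le_incidences_of_star {p₀ : EuclideanSpace ℝ (Fin d)}
    {h₀ : AffineSubspace ℝ (EuclideanSpace ℝ (Fin d))} (hp₀ : p₀ ∈ P) (hh₀ : h₀ ∈ H)
    (hP : ∀ p ∈ P, p ∈ h₀) (hH : ∀ h ∈ H, p₀ ∈ h) : max P.card H.card ≤ incidences P H := by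
  refine max_le ?_ ?_
  · simpa using card_le_incidences (I := P ×ˢ {h₀})
      (Finset.product_subset_product_right (Finset.singleton_subset_iff.2 hh₀))
      (by simpa using hP)
  · simpa using card_le_incidences (I := {p₀} ×ˢ H)
      (Finset.product_subset_product_left (Finset.singleton_subset_iff.2 hp₀))
      (by simpa using hH)

theorem hasConfiguration_two_two (hd : 2 ≤ d) (hm : 1 ≤ m) (hn : 1 ≤ n) :
    HasConfiguration d 2 2 m n ((m + n) / 2) := by
  classical
  obtain ⟨e₀, e₁, h₀, h₁, h₀₁⟩ : ∃ e₀ e₁ : EuclideanSpace ℝ (Fin d),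
      ‖e₀‖ = 1 ∧ ‖e₁‖ = 1 ∧ inner ℝ e₀ e₁ = (0 : ℝ) :=
    ⟨EuclideanSpace.single ⟨0, by omega⟩ 1, EuclideanSpace.single ⟨1, by omega⟩ 1, by simp,
      by simp, by simp [EuclideanSpace.inner_single_left]⟩
  have h₁₀ : inner ℝ e₁ e₀ = (0 : ℝ) := by rw [real_inner_comm, h₀₁]
  have he₀ : e₀ ≠ 0 := norm_ne_zero_iff.1 (by simp [h₀])
  have he₁ : e₁ ≠ 0 := norm_ne_zero_iff.1 (by simp [h₁])
  let point (l : ℕ) := (l : ℝ) • e₀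
  let plane (k : ℕ) := normalHyperplane (e₁ + (k : ℝ) • e₀) 0
  have hmem (l k : ℕ) : point l ∈ plane k ↔ l = 0 ∨ k = 0 := by
    simp [point, plane, mem_normalHyperplane, inner_add_left, inner_smul_left, inner_smul_right,
      h₁₀, he₀]
  have hpoint : Function.Injective point := fun l l' h => by
    simpa [point, he₀] using h
  have hplane : Function.Injective plane := fun k k' h => by
    have hk (j : ℕ) : e₀ - (k : ℝ) • e₁ ∈ plane j ↔ (j : ℝ) = k := by
      simp [plane, mem_normalHyperplane, inner_add_left, inner_smul_left, inner_sub_right,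
        inner_smul_right, h₀, h₁, h₀₁, h₁₀, sub_eq_zero]
    exact_mod_cast ((hk k').1 (h ▸ (hk k).2 rfl)).symm
  let P := (Finset.range m).image point
  let H := (Finset.range n).image plane
  have hP : P.card = m := by rw [Finset.card_image_of_injective _ hpoint, Finset.card_range]
  have hH : H.card = n := by rw [Finset.card_image_of_injective _ hplane, Finset.card_range]
  refine ⟨P, H, hP, hH, ?_, not_containsK_two_two_of_star (p₀ := point 0) (h₀ := plane 0) ?_, ?_⟩
  · simp only [H, Finset.forall_mem_image]
    refine fun k _ => isHyperplane_normalHyperplane (fun h => ?_) _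
    simpa [inner_add_right, inner_smul_right, h₁₀, he₁] using congrArg (inner ℝ e₁) h
  · simp only [P, H, Finset.forall_mem_image, hmem, hpoint.eq_iff, hplane.eq_iff]
    exact fun _ _ _ _ => id
  · have hI : max P.card H.card ≤ incidences P H := max_card_le_incidences_of_star
      (Finset.mem_image_of_mem point (Finset.mem_range.2 hm))
      (Finset.mem_image_of_mem plane (Finset.mem_range.2 hn))
      (by simp [P, hmem]) (by simp [H, hmem])
    rw [hP, hH, max_le_iff] at hI
    have hm' : (m : ℝ) ≤ incidences P H := by exact_mod_cast hI.1
    have hn' : (n : ℝ) ≤ incidences P H := by exact_mod_cast hI.2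
    linarith

end Configurations

section Construction

/-- Any `s + 1` distinct points of `P` are affinely independent. -/
def InGeneralPosition {E : Type*} [AddCommGroup E] [Module ℝ E] (s : ℕ) (P : Set E) : Prop :=
  ∀ f : Fin (s + 1) → E, Function.Injective f → (∀ i, f i ∈ P) → AffineIndependent ℝ f

variable {d s t : ℕ} {P N : Finset (EuclideanSpace ℝ (Fin d))}
  {H : Finset (AffineSubspace ℝ (EuclideanSpace ℝ (Fin d)))}

theorem InGeneralPosition.finrank_vectorSpan_orthogonal {P : Set (EuclideanSpace ℝ (Fin d))}
    (hP : InGeneralPosition s P) {S : Finset (EuclideanSpace ℝ (Fin d))} (hS : ↑S ⊆ P)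
    (hcard : S.card = s + 1) :
    Module.finrank ℝ (vectorSpan ℝ (S : Set (EuclideanSpace ℝ (Fin d))))ᗮ = d - s := by
  let f (i : Fin (s + 1)) : EuclideanSpace ℝ (Fin d) := ((S.equivFinOfCardEq hcard).symm i : S)
  have hf : AffineIndependent ℝ f :=
    hP f (Subtype.val_injective.comp (Equiv.injective _)) fun i => hS (Subtype.coe_prop _)
  have hrange : Set.range f = S := by
    rw [show f = Subtype.val ∘ (S.equivFinOfCardEq hcard).symm from rfl, EquivLike.range_comp,
      Subtype.range_coe_subtype]
    rfl
  have hspan : Module.finrank ℝ (vectorSpan ℝ (S : Set (EuclideanSpace ℝ (Fin d)))) = s :=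
    hrange ▸ hf.finrank_vectorSpan (Fintype.card_fin _)
  have hadd := Submodule.finrank_add_finrank_orthogonal
    (vectorSpan ℝ (S : Set (EuclideanSpace ℝ (Fin d))))
  rw [hspan, finrank_euclideanSpace_fin] at hadd
  omega

theorem not_containsK_of_inGeneralPosition {N : Set (EuclideanSpace ℝ (Fin d))}
    (hP : InGeneralPosition s (P : Set (EuclideanSpace ℝ (Fin d))))
    (hN : IsSubspaceEvasive ℝ (d - s) t N) (hH : ∀ h ∈ H, ∃ u ∈ N, ∃ r, normalHyperplane u r = h) :
    ¬ ContainsK (s + 1) (t + 1) P H := by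
  classical
  rintro ⟨S, hS, T, hT, hScard, hTcard, hST⟩
  choose! normal hnormal level hlevel using hH
  obtain ⟨p, hp⟩ := Finset.card_ne_zero.1 (hScard.trans_ne s.succ_ne_zero)
  have hmem (h) (hh : h ∈ T) (x) (hx : x ∈ S) : inner ℝ (normal h) x = level h :=
    mem_normalHyperplane.1 ((hlevel h (hT hh)).symm ▸ hST x hx h hh)
  have hinj : Set.InjOn normal T := fun h hh h' hh' heq => by
    rw [← hlevel h (hT hh), ← hlevel h' (hT hh'), heq, ← hmem h hh p hp, ← hmem h' hh' p hp, heq]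
  have horth : Submodule.span ℝ ((T.image normal : Finset _) : Set (EuclideanSpace ℝ (Fin d))) ≤
      (vectorSpan ℝ (S : Set (EuclideanSpace ℝ (Fin d))))ᗮ := by
    rw [Submodule.span_le, Finset.coe_image, Set.image_subset_iff]
    exact fun h hh => mem_vectorSpan_orthogonal_of_subset_normalHyperplane (hmem h hh)
  have hdim := (Submodule.finrank_mono horth).trans_eq (hP.finrank_vectorSpan_orthogonal hS hScard)
  have hle := hN (T.image normal) (by
    rw [Finset.coe_image]
    exact Set.image_subset_iff.2 fun h hh => hnormal h (hT hh)) hdim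
  rw [Finset.card_image_of_injOn hinj] at hle
  omega

theorem card_mul_card_le_incidences (h0 : 0 ∉ N)
    (hN : Set.InjOn (fun u => Submodule.span ℝ {u}) (N : Set (EuclideanSpace ℝ (Fin d))))
    (hH : ∀ x ∈ P, ∀ u ∈ N, normalHyperplane u (inner ℝ u x) ∈ H) :
    P.card * N.card ≤ incidences P H := by
  classical
  let flag (z : EuclideanSpace ℝ (Fin d) × EuclideanSpace ℝ (Fin d)) :=
    (z.1, normalHyperplane z.2 (inner ℝ z.2 z.1))
  have hinj : Set.InjOn flag (P ×ˢ N : Finset _) := by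
    rintro ⟨x, u⟩ hxu ⟨y, v⟩ hyv h
    have hu := (Finset.mem_product.1 hxu).2
    have hv := (Finset.mem_product.1 hyv).2
    obtain ⟨hxy, huv⟩ := Prod.mk.inj h
    exact Prod.ext hxy (hN hu hv (span_eq_span_of_normalHyperplane_eq (ne_of_mem_of_not_mem hu h0)
      (ne_of_mem_of_not_mem hv h0) huv))
  rw [← Finset.card_product, ← Finset.card_image_of_injOn hinj]
  refine card_le_incidences (fun q hq => ?_) fun q hq => ?_
  · obtain ⟨⟨x, u⟩, hxu, rfl⟩ := Finset.mem_image.1 hq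
    obtain ⟨hx, hu⟩ := Finset.mem_product.1 hxu
    exact Finset.mem_product.2 ⟨hx, hH x hx u hu⟩
  · obtain ⟨⟨x, u⟩, -, rfl⟩ := Finset.mem_image.1 hq
    exact mem_normalHyperplane.2 rfl

theorem hasConfiguration_of_normals [NeZero d] {a b n : ℕ} (hPa : P ⊆ latticeCube d a)
    (hP : InGeneralPosition s (P : Set (EuclideanSpace ℝ (Fin d)))) (hNb : N ⊆ latticeCube d b)
    (h0 : 0 ∉ N)
    (hinj : Set.InjOn (fun u => Submodule.span ℝ {u}) (N : Set (EuclideanSpace ℝ (Fin d))))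
    (hN : IsSubspaceEvasive ℝ (d - s) t (N : Set (EuclideanSpace ℝ (Fin d))))
    (hn : N.card * (2 * (d * (b * a)) + 1) ≤ n) :
    HasConfiguration d (s + 1) (t + 1) P.card n ((P.card * N.card : ℕ) : ℝ) := by
  classical
  let levels : Finset ℤ := Finset.Icc (-(d * (b * a) : ℕ)) (d * (b * a) : ℕ)
  let H := (N ×ˢ levels).image fun z => normalHyperplane z.1 (z.2 : ℝ)
  have hH : ∀ h ∈ H, ∃ u ∈ N, ∃ r : ℝ, normalHyperplane u r = h := by
    simp only [H, Finset.forall_mem_image, Finset.mem_product]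
    exact fun z hz => ⟨z.1, hz.1, _, rfl⟩
  have hcard : H.card ≤ n := by
    refine (Finset.card_image_le.trans_eq ?_).trans hn
    rw [Finset.card_product, Int.card_Icc]
    congr
    omega
  have hflag : ∀ x ∈ P, ∀ u ∈ N, normalHyperplane u (inner ℝ u x) ∈ H := fun x hx u hu => by
    obtain ⟨z, hz, hzx⟩ := exists_inner_eq_of_mem_latticeCube (hNb hu) (hPa hx)
    refine Finset.mem_image.2 ⟨(u, z), Finset.mem_product.2 ⟨hu, ?_⟩, by rw [hzx]⟩
    exact Finset.mem_Icc.2 (abs_le.1 (by exact_mod_cast hz))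
  refine (hasConfiguration_of_card_le s.succ_ne_zero hcard (fun h hh => ?_)
    (not_containsK_of_inGeneralPosition hP hN hH)).mono le_rfl le_rfl ?_
  · obtain ⟨u, hu, r, rfl⟩ := hH h hh
    exact isHyperplane_normalHyperplane (ne_of_mem_of_not_mem hu h0) r
  · exact_mod_cast card_mul_card_le_incidences h0 hinj hflag

end Construction

section LatticePoints

theorem inGeneralPosition_one {E : Type*} [AddCommGroup E] [Module ℝ E] (P : Set E) :
    InGeneralPosition 1 P := fun f hf _ => by
  have hpair : f = ![f 0, f 1] := funext fun i => by fin_cases i <;> rfl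
  exact hpair ▸ affineIndependent_of_ne ℝ (hf.ne (by decide))

theorem inGeneralPosition_two_of_cospherical {E : Type*} [NormedAddCommGroup E]
    [InnerProductSpace ℝ E] {P : Set E} (hP : EuclideanGeometry.Cospherical P) :
    InGeneralPosition 2 P :=
  fun _ hf hfP => hP.affineIndependent (Set.range_subset_iff.2 hfP) hf

theorem exists_nat_root {g : ℕ} (hg : g ≠ 0) (k : ℕ) :
    ∃ a : ℕ, (a : ℝ) ≤ (k : ℝ) ^ (1 / (g : ℝ)) ∧ k < (a + 1) ^ g := by
  refine ⟨g.nthRoot k, ?_, Nat.lt_pow_nthRoot_add_one hg k⟩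
  rw [one_div, Real.le_rpow_inv_iff_of_pos (by positivity) (by positivity) (by positivity),
    Real.rpow_natCast]
  exact_mod_cast Nat.pow_nthRoot_le (.inl hg)

theorem exists_inGeneralPosition_one {d : ℕ} (hd : d ≠ 0) (m : ℕ) :
    ∃ (a : ℕ) (P : Finset (EuclideanSpace ℝ (Fin d))), (a : ℝ) ≤ (m : ℝ) ^ (1 / (d : ℝ)) ∧
      P ⊆ latticeCube d a ∧ P.card = m ∧
      InGeneralPosition 1 (P : Set (EuclideanSpace ℝ (Fin d))) := by
  obtain ⟨a, ha, hma⟩ := exists_nat_root hd m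
  have hcard : m ≤ (latticeCube d a).card := by
    rw [card_latticeCube]
    exact hma.le.trans (Nat.pow_le_pow_left (by omega) d)
  obtain ⟨P, hP, hPm⟩ := Finset.exists_subset_card_eq hcard
  exact ⟨a, P, ha, hP, hPm, inGeneralPosition_one _⟩

theorem exists_cospherical_subset_latticeCube {d m a : ℕ}
    (hm : (d * (a * a) + 1) * m ≤ (2 * a + 1) ^ d) :
    ∃ P ⊆ latticeCube d a, P.card = m ∧
      EuclideanGeometry.Cospherical (P : Set (EuclideanSpace ℝ (Fin d))) := by
  classical
  let norms : Finset ℝ := (Finset.range (d * (a * a) + 1)).image Nat.cast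
  have hmaps : ∀ x ∈ latticeCube d a, inner ℝ x x ∈ norms := fun x hx => by
    obtain ⟨z, hz, hzx⟩ := exists_inner_eq_of_mem_latticeCube hx hx
    have hz0 : 0 ≤ z := by exact_mod_cast hzx ▸ real_inner_self_nonneg (x := x)
    lift z to ℕ using hz0
    rw [Nat.abs_cast] at hz
    exact Finset.mem_image.2 ⟨z, Finset.mem_range_succ_iff.2 (by exact_mod_cast hz), hzx.symm⟩
  have hcard : norms.card * m ≤ (latticeCube d a).card := by
    rw [card_latticeCube, Finset.card_image_of_injective _ Nat.cast_injective, Finset.card_range]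
    exact hm
  obtain ⟨r, -, hr⟩ := Finset.exists_le_card_fiber_of_mul_le_card_of_maps_to hmaps
    (Finset.image_nonempty.2 Finset.nonempty_range_add_one) hcard
  obtain ⟨P, hP, hPm⟩ := Finset.exists_subset_card_eq hr
  refine ⟨P, hP.trans (Finset.filter_subset _ _), hPm, 0, √r, fun x hx => ?_⟩
  rw [dist_zero_right, norm_eq_sqrt_real_inner, (Finset.mem_filter.1 (hP hx)).2]

theorem exists_inGeneralPosition_two {d : ℕ} (hd : 3 ≤ d) (m : ℕ) :
    ∃ (a : ℕ) (P : Finset (EuclideanSpace ℝ (Fin d))),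
      (a : ℝ) ≤ d * (m : ℝ) ^ (1 / ((d - 2 : ℕ) : ℝ)) ∧ P ⊆ latticeCube d a ∧ P.card = m ∧
      InGeneralPosition 2 (P : Set (EuclideanSpace ℝ (Fin d))) := by
  obtain ⟨a, ha, hma⟩ := exists_nat_root (by omega : d - 2 ≠ 0) (d * m)
  have hcard : (d * (a * a) + 1) * m ≤ (2 * a + 1) ^ d := calc
    (d * (a * a) + 1) * m ≤ d * (2 * a + 1) ^ 2 * m := Nat.mul_le_mul_right _ (by nlinarith)
    _ = d * m * (2 * a + 1) ^ 2 := by ring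
    _ ≤ (a + 1) ^ (d - 2) * (2 * a + 1) ^ 2 := Nat.mul_le_mul_right _ hma.le
    _ ≤ (2 * a + 1) ^ (d - 2) * (2 * a + 1) ^ 2 := by gcongr; omega
    _ = (2 * a + 1) ^ d := by rw [← pow_add, Nat.sub_add_cancel (by omega)]
  obtain ⟨P, hP, hPm, hPsphere⟩ := exists_cospherical_subset_latticeCube hcard
  refine ⟨a, P, ha.trans ?_, hP, hPm, inGeneralPosition_two_of_cospherical hPsphere⟩
  have hd1 : (1 : ℝ) ≤ d := by exact_mod_cast (by omega : 1 ≤ d)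
  have hg : (1 : ℝ) ≤ (d - 2 : ℕ) := by exact_mod_cast (by omega : 1 ≤ d - 2)
  rw [Nat.cast_mul, Real.mul_rpow (by positivity) (by positivity)]
  gcongr
  exact (Real.rpow_le_rpow_of_exponent_le hd1 ((div_le_one₀ (by positivity)).2 hg)).trans_eq
    (Real.rpow_one _)

end LatticePoints

section IncidenceBound

theorem exists_pow_le_and_le_two_mul_pow {e : ℕ} (he : e ≠ 0) {Z : ℝ} (hZ : 2 ^ e ≤ Z) :
    ∃ q : ℕ, 1 < q ∧ (q : ℝ) ^ e ≤ Z ∧ Z ≤ (2 * q) ^ e := by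
  have hZ0 : 0 ≤ Z := le_trans (by positivity) hZ
  have hq : 2 ≤ e.nthRoot ⌊Z⌋₊ := (Nat.le_nthRoot_iff he).2 (Nat.le_floor (by exact_mod_cast hZ))
  refine ⟨e.nthRoot ⌊Z⌋₊, hq, ?_, ?_⟩
  · refine le_trans ?_ (Nat.floor_le hZ0)
    exact_mod_cast Nat.pow_nthRoot_le (.inl he)
  · have hlt : ⌊Z⌋₊ + 1 ≤ (2 * e.nthRoot ⌊Z⌋₊) ^ e :=
      (Nat.lt_pow_nthRoot_add_one he _).trans_le (Nat.pow_le_pow_left (by omega) e)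
    exact (Nat.lt_floor_add_one Z).le.trans (by exact_mod_cast hlt)

theorem pow_rpow_eq_pow_of_mul_eq {x : ℝ} (hx : 0 ≤ x) {e k : ℕ} {δ : ℝ} (h : e * δ = k) :
    (x ^ e) ^ δ = x ^ k := by
  rw [← Real.rpow_natCast, ← Real.rpow_mul hx, h, Real.rpow_natCast]

theorem rpow_one_sub_mul_rpow_eq {x y K : ℝ} (hx : 0 < x) (hy : 0 ≤ y) (hK : 0 < K) (β δ : ℝ) :
    x ^ (1 - β * δ) * y ^ δ = K ^ δ * (x * (y / (K * x ^ β)) ^ δ) := by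
  rw [Real.div_rpow hy (by positivity), Real.mul_rpow hK.le (by positivity), ← Real.rpow_mul hx.le,
    Real.rpow_sub hx, Real.rpow_one]
  field_simp

variable {d s : ℕ}

theorem hasConfiguration_of_inGeneralPosition {a n : ℕ} {P : Finset (EuclideanSpace ℝ (Fin d))}
    (hs : s ≠ 0) (hsd : s + 1 ≤ d) (hPa : P ⊆ latticeCube d a)
    (hP : InGeneralPosition s (P : Set (EuclideanSpace ℝ (Fin d)))) {δ : ℝ} (hδ0 : 0 ≤ δ)
    (hδ : (d * s + d - 1 : ℕ) * δ = (d * s : ℕ)) {Y : ℝ} (hY : 4 * d * a + 1 ≤ Y)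
    (hYn : 2 ^ (d * s + d - 1) * Y ≤ n) :
    HasConfiguration d (s + 1) (2 ^ d.choose 2 + 1) P.card n
      (P.card * (n / Y) ^ δ / 2 ^ (d * s)) := by
  have : NeZero d := ⟨by omega⟩
  have hY0 : 0 < Y := lt_of_lt_of_le (by positivity) hY
  obtain ⟨q, hq, hqn, hnq⟩ := exists_pow_le_and_le_two_mul_pow (by omega : d * s + d - 1 ≠ 0)
    ((le_div_iff₀ hY0).2 hYn)
  obtain ⟨N, hNb, hNcard, h0, hinj, hN⟩ := exists_evasive_normals hsd hq
  have hn : N.card * (2 * (d * (2 * q ^ (d - 1) * a)) + 1) ≤ n := by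
    have hq1 : (1 : ℝ) ≤ q ^ (d - 1) := one_le_pow₀ (by exact_mod_cast hq.le)
    rify
    calc (N.card : ℝ) * (2 * (d * (2 * q ^ (d - 1) * a)) + 1)
        ≤ q ^ (d * s) * (q ^ (d - 1) * (4 * d * a + 1)) := by
          rw [hNcard, Nat.cast_pow]
          gcongr
          linarith
      _ ≤ q ^ (d * s) * (q ^ (d - 1) * Y) := by gcongr
      _ = q ^ (d * s + d - 1) * Y := by rw [Nat.add_sub_assoc (by omega), pow_add, mul_assoc]
      _ ≤ n := (le_div_iff₀ hY0).1 hqn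
  have hpow : (n / Y) ^ δ ≤ (2 : ℝ) ^ (d * s) * q ^ (d * s) := calc
    (n / Y) ^ δ ≤ ((2 * q : ℝ) ^ (d * s + d - 1)) ^ δ := by gcongr
    _ = (2 * q) ^ (d * s) := pow_rpow_eq_pow_of_mul_eq (by positivity) hδ
    _ = 2 ^ (d * s) * q ^ (d * s) := mul_pow _ _ _
  refine (hasConfiguration_of_normals hPa hP hNb h0 hinj hN hn).mono le_rfl le_rfl ?_
  rw [div_le_iff₀ (by positivity), hNcard]
  push_cast
  calc (P.card : ℝ) * (n / Y) ^ δ ≤ P.card * (2 ^ (d * s) * q ^ (d * s)) := by gcongr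
    _ = P.card * q ^ (d * s) * 2 ^ (d * s) := by ring

theorem exists_hasConfiguration (hs : s ≠ 0) (hsd : s + 1 ≤ d) {A β δ : ℝ} (hA : 1 ≤ A)
    (hβ : 0 ≤ β) (hδ0 : 0 ≤ δ) (hδ : (d * s + d - 1 : ℕ) * δ = (d * s : ℕ))
    (hpts : ∀ m : ℕ, ∃ (a : ℕ) (P : Finset (EuclideanSpace ℝ (Fin d))), (a : ℝ) ≤ A * (m : ℝ) ^ β ∧
      P ⊆ latticeCube d a ∧ P.card = m ∧
      InGeneralPosition s (P : Set (EuclideanSpace ℝ (Fin d)))) :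
    ∃ c : ℝ, 0 < c ∧ ∀ m n : ℕ, 1 ≤ m → 1 ≤ n → HasConfiguration d (s + 1) (2 ^ d.choose 2 + 1) m n
      (c * ((m : ℝ) ^ (1 - β * δ) * (n : ℝ) ^ δ + m + n)) := by
  have hd0 : (1 : ℝ) ≤ d := by exact_mod_cast (by omega : 1 ≤ d)
  set B : ℝ := (5 * d * A) ^ δ * 2 ^ (d * s) with hB
  have hB0 : 0 < B := by positivity
  refine ⟨1 / (2 * (B + 1)), by positivity, fun m n hm hn => ?_⟩
  set main : ℝ := (m : ℝ) ^ (1 - β * δ) * (n : ℝ) ^ δ with hmain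
  by_cases hsmall : main ≤ B * (m + n)
  · refine (hasConfiguration_two_two (by omega) hm hn).mono (by omega)
      (Nat.succ_le_succ Nat.one_le_two_pow) ?_
    rw [div_mul_eq_mul_div, one_mul, div_le_iff₀ (by positivity)]
    linarith
  have hm1 : (1 : ℝ) ≤ m := by exact_mod_cast hm
  have hmβ : 1 ≤ (m : ℝ) ^ β := Real.one_le_rpow hm1 hβ
  set Y : ℝ := 5 * d * A * (m : ℝ) ^ β with hYdef
  have hY0 : 0 < Y := by positivity
  set x : ℝ := m * (n / Y) ^ δ / 2 ^ (d * s) with hx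
  have hmain_eq : main = B * x := by
    rw [hmain, rpow_one_sub_mul_rpow_eq (by positivity) n.cast_nonneg (K := 5 * d * A)
      (by positivity), ← hYdef, hB, hx]
    field_simp
  have hlarge : m + n < x := lt_of_mul_lt_mul_left (hmain_eq ▸ not_le.1 hsmall) hB0.le
  have hYn : 2 ^ (d * s + d - 1) * Y ≤ n := by
    rw [← le_div_iff₀ hY0]
    by_contra! hlt
    have hxm : x ≤ m := by
      rw [hx, div_le_iff₀ (by positivity), ← pow_rpow_eq_pow_of_mul_eq zero_le_two hδ]
      gcongr
    linarith [Nat.cast_nonneg (α := ℝ) n]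
  obtain ⟨a, P, ha, hPa, rfl, hP⟩ := hpts m
  have hY : 4 * d * a + 1 ≤ Y := calc
    4 * d * a + 1 ≤ 4 * d * (A * (P.card : ℝ) ^ β) + 1 * 1 * 1 := by gcongr; norm_num
    _ ≤ 4 * d * (A * (P.card : ℝ) ^ β) + d * A * (P.card : ℝ) ^ β := by gcongr
    _ = Y := by ring
  refine (hasConfiguration_of_inGeneralPosition hs hsd hPa hP hδ0 hδ hY hYn).mono le_rfl le_rfl ?_
  rw [hmain_eq, div_mul_eq_mul_div, one_mul, div_le_iff₀ (by positivity)]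
  nlinarith [mul_nonneg hB0.le (show 0 ≤ x by positivity)]

theorem HasConfiguration.rpow_sub {t m n : ℕ} {c x y ε : ℝ}
    (h : HasConfiguration d s t m n (c * ((m : ℝ) ^ x * (n : ℝ) ^ y + m + n))) (hc : 0 ≤ c)
    (hn : 1 ≤ n) (hε : 0 ≤ ε) :
    HasConfiguration d s t m n (c * ((m : ℝ) ^ x * (n : ℝ) ^ (y - ε) + m + n)) := by
  refine h.mono le_rfl le_rfl ?_
  gcongr
  · exact_mod_cast hn
  · linarith

end IncidenceBound

theorem theorem1p3_general (d : ℕ) (hd : 2 ≤ d) :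
    ∃ t : ℕ,
      (∃ c : ℝ, 0 < c ∧ ∀ m n : ℕ, 1 ≤ m → 1 ≤ n →
        HasConfiguration d 2 (t + 1) m n
          (c * ((m : ℝ) ^ ((2 * (d : ℝ) - 2) / (2 * (d : ℝ) - 1)) *
            (n : ℝ) ^ ((d : ℝ) / (2 * (d : ℝ) - 1)) + (m : ℝ) + (n : ℝ)))) ∧
      (3 ≤ d → ∃ c : ℝ, 0 < c ∧ ∀ m n : ℕ, 1 ≤ m → 1 ≤ n →
        HasConfiguration d 3 (t + 1) m n
          (c * ((m : ℝ) ^ ((3 * (d : ℝ) ^ 2 - 9 * (d : ℝ) + 2) /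
              (((d : ℝ) - 2) * (3 * (d : ℝ) - 1))) *
            (n : ℝ) ^ (2 * (d : ℝ) / (3 * (d : ℝ) - 1)) + (m : ℝ) + (n : ℝ)))) := by
  have hd' : (2 : ℝ) ≤ d := by exact_mod_cast hd
  have hd₂ : 0 < 2 * (d : ℝ) - 1 := by linarith
  have hd₃ : 0 < 3 * (d : ℝ) - 1 := by linarith
  refine ⟨2 ^ d.choose 2, ?_, fun hd3 => ?_⟩
  · have hδ : (d * 1 + d - 1 : ℕ) * ((d : ℝ) / (2 * d - 1)) = (d * 1 : ℕ) := by
      rw [Nat.cast_sub (by omega)]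
      push_cast
      rw [mul_div_assoc', div_eq_iff hd₂.ne']
      ring
    have hexp : (2 * (d : ℝ) - 2) / (2 * d - 1) = 1 - 1 / d * (d / (2 * d - 1)) := by
      field_simp
      ring
    rw [hexp]
    exact exists_hasConfiguration one_ne_zero hd le_rfl (by positivity) (by positivity) hδ
      (by simpa using exists_inGeneralPosition_one (by omega))
  · have hδ : (d * 2 + d - 1 : ℕ) * (2 * (d : ℝ) / (3 * d - 1)) = (d * 2 : ℕ) := by
      rw [Nat.cast_sub (by omega)]
      push_cast
      rw [mul_div_assoc', div_eq_iff hd₃.ne']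
      ring
    have hexp : (3 * (d : ℝ) ^ 2 - 9 * d + 2) / ((d - 2) * (3 * d - 1)) =
        1 - 1 / (d - 2 : ℕ) * (2 * d / (3 * d - 1)) := by
      have hd2 : (0 : ℝ) < d - 2 := by rify at hd3; linarith
      rw [Nat.cast_sub hd]
      push_cast
      field_simp
      ring
    rw [hexp]
    exact exists_hasConfiguration two_ne_zero hd3 (by linarith) (by positivity) (by positivity) hδ
      (exists_inGeneralPosition_two hd3)

theorem theorem1p3 (d : ℕ) (hd : 2 ≤ d) :
    ∃ t : ℕ, ∀ ε : ℝ, 0 < ε →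
      (∀ C : ℝ, ∃ c : ℝ, 0 < c ∧
        ∀ m n : ℕ, 1 ≤ m → 1 ≤ n → (m : ℝ) ≤ C * (n : ℝ) ^ d →
          ∃ (P : Finset (EuclideanSpace ℝ (Fin d)))
            (H : Finset (AffineSubspace ℝ (EuclideanSpace ℝ (Fin d)))),
            P.card = m ∧ H.card = n ∧ (∀ h ∈ H, IsHyperplane h) ∧
            ¬ ContainsK 2 (t + 1) P H ∧
            c * ((m : ℝ) ^ ((2 * (d : ℝ) - 2) / (2 * (d : ℝ) - 1)) *
                  (n : ℝ) ^ ((d : ℝ) / (2 * (d : ℝ) - 1) - ε) + (m : ℝ) + (n : ℝ))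
              ≤ (incidences P H : ℝ)) ∧
      (4 ≤ d → ∀ C : ℝ, ∃ c : ℝ, 0 < c ∧
        ∀ m n : ℕ, 1 ≤ m → 1 ≤ n → (m : ℝ) ≤ C * (n : ℝ) ^ (d - 2) →
          ∃ (P : Finset (EuclideanSpace ℝ (Fin d)))
            (H : Finset (AffineSubspace ℝ (EuclideanSpace ℝ (Fin d)))),
            P.card = m ∧ H.card = n ∧ (∀ h ∈ H, IsHyperplane h) ∧
            ¬ ContainsK 3 (t + 1) P H ∧
            c * ((m : ℝ) ^ ((3 * (d : ℝ) ^ 2 - 9 * (d : ℝ) + 2) /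
                    (((d : ℝ) - 2) * (3 * (d : ℝ) - 1))) *
                  (n : ℝ) ^ (2 * (d : ℝ) / (3 * (d : ℝ) - 1) - ε) + (m : ℝ) + (n : ℝ))
              ≤ (incidences P H : ℝ)) := by
  obtain ⟨t, ⟨c, hc, ha⟩, hb⟩ := theorem1p3_general d hd
  refine ⟨t, fun ε hε => ⟨fun _ => ⟨c, hc, fun m n hm hn _ => ?_⟩, fun hd4 _ => ?_⟩⟩
  · exact (ha m n hm hn).rpow_sub hc.le hn hε.le
  · obtain ⟨c, hc, hb⟩ := hb (by omega)
    exact ⟨c, hc, fun m n hm hn _ => (hb m n hm hn).rpow_sub hc.le hn hε.le⟩
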